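/- Conventions. For a finite sequence $x=(x_1,\dots,x_n)$ of nonnegative integers let $\mathrm{Asc}(x)$ be the increasing list of positions $i\in\{1,\dots,n-1\}$ with $x_i<x_{i+1}$, and let $\mathrm{asc}(x)$ be its length. For $n\ge 1$, $x$ is an ascent sequence if $x_1=0$ and $0\le x_i\le 1+\mathrm{asc}(x_1,\dots,x_{i-1})$ for $2\le i\le n$; the empty sequence ($n=0$) is also an ascent sequence. Its modified sequence $\widehat x$ is obtained from $x$ as follows: with $\mathrm{Asc}(x)=(a_1,\dots,a_k)$ computed once from the input, for $i=a_1,\dots,a_k$ in this order, every current entry $x_j$ with $1\le j\le i-1$ and $x_j\ge x_{i+1}$ is increased by $1$. Let $\mathcal R_n$ be the set of permutations $\pi=\pi_1\cdots\pi_n$ of $\{1,\dots,n\}$ for which there are no indices $i<j<k$ with $\pi_k<\pi_i<\pi_j$, $j=i+1$ and $\pi_i=\pi_k+1$. For $\tau\in\mathcal R_{n}$, a site of $\tau$ (one of the $n+1$ gaps before, between and after its entries) is active if inserting $n+1$ there produces an element of $\mathcal R_{n+1}$; the active sites are labelled $0,1,2,\dots$ from left to right. Deleting $n$ from a permutation in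 $\mathcal R_n$ ($n\ge 2$) gives a permutation in $\mathcal R_{n-1}$. The map $\Lambda$ from $\mathcal R_n$ to sequences of length $n$ is defined by $\Lambda(1)=(0)$ (and by sending the empty permutation to the empty sequence) and, for $n\ge2$, if $\pi\in\mathcal R_n$ arises by inserting $n$ in the active site labelled $i$ of $\tau\in\mathcal R_{n-1}$, by $\Lambda(\pi)=(x_1,\dots,x_{n-1},i)$ where $(x_1,\dots,x_{n-1})=\Lambda(\tau)$. Corollary 4.2. Let $x$ be an ascent sequence of length $n\ge0$. Sort the pairs $(\widehat x_i,i)$, $1\le i\le n$, in increasing order of the first entry, breaking ties by decreasing order of the second entry, and let $\pi$ be the word formed by the second entries. Then $\pi=\Lambda^{-1}(x)$; that is, $\pi$ is the unique element of $\mathcal R_n$ with $\Lambda(\pi)=x$. Moreover, for every integer $i\ge 0$, the number of entries of $\pi$ between the active sites of $\pi$ labelled $i$ and $i+1$ equals the number of entries of $\widehat x$ equal to $i$ (where the former number is $0$ if $\pi$ does not have both of these active sites). -/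

import Mathlib

namespace AscentPerm

/-- The positions of the ascents of `l`, in increasing order. Positions are counted from `0`:
`j` is listed when the entry number `j` is smaller than the entry number `j + 1`. -/
def ascList (l : List ℕ) : List ℕ :=
  (List.range (l.length - 1)).filter (fun j => l.getD j 0 < l.getD (j + 1) 0)

/-- The number of ascents. -/
def asc (l : List ℕ) : ℕ := (ascList l).length

/-- `x = (x_1, …, x_n)` is an ascent sequence: `x_1 = 0` and each later entry is at most
one more than the number of ascents of the prefix that precedes it. The empty sequence is an
ascent sequence. -/
def IsAscentSeq (x : List ℕ) : Prop :=
  (∀ h : 0 < x.length, x[0] = 0) ∧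
    ∀ (i : ℕ) (h : i < x.length), 1 ≤ i → x[i] ≤ 1 + asc (x.take i)

/-- One pass of the outer loop of the modification algorithm, for the position `i` (from `0`):
every entry strictly to the left of position `i` that is at least the entry number `i + 1` is
incremented. -/
def bump (l : List ℕ) (i : ℕ) : List ℕ :=
  l.mapIdx (fun j v => if j < i ∧ l.getD (i + 1) 0 ≤ v then v + 1 else v)

/-- The modified sequence `x̂`: the passes are run over the ascents of the input `x`,
from left to right. -/
def hat (x : List ℕ) : List ℕ := (ascList x).foldl bump x

/-- No `i < j < k` with `π_i π_j π_k` order isomorphic to `231`, `j = i + 1` and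
`π_i = π_k + 1`. -/
def Avoids (π : List ℕ) : Prop :=
  ∀ i j k : Fin π.length, i < j → j < k →
    (π[k] < π[i] ∧ π[i] < π[j]) → ((j : ℕ) ≠ i + 1 ∨ π[i] ≠ π[k] + 1)

/-- The permutations of `{1, …, n}`, in one-line notation, that avoid the bivincular pattern. -/
def R (n : ℕ) : Set (List ℕ) :=
  {π | π.Perm (List.range' 1 n) ∧ Avoids π}

instance instDecidableAvoids (π : List ℕ) : Decidable (Avoids π) := by
  unfold Avoids; infer_instance

instance instDecidableMemR (n : ℕ) (π : List ℕ) : Decidable (π ∈ R n) :=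
  inferInstanceAs (Decidable (π.Perm (List.range' 1 n) ∧ Avoids π))

/-- The site `p` of `τ` (the gap preceded by exactly `p` entries) is active when inserting there
a new maximal entry produces an element of `R`. -/
def Active (τ : List ℕ) (p : ℕ) : Prop :=
  τ.insertIdx p (τ.length + 1) ∈ R (τ.length + 1)

instance instDecidableActive (τ : List ℕ) (p : ℕ) : Decidable (Active τ p) :=
  inferInstanceAs (Decidable (τ.insertIdx p (τ.length + 1) ∈ R (τ.length + 1)))

/-- The active sites of `τ` from left to right; the label of an active site is its index
(from `0`) in this list. -/
def activeSites (τ : List ℕ) : List ℕ :=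
  (List.range (τ.length + 1)).filter (fun p => Active τ p)

/-- The map from permutations in `R n` to sequences of length `n`: delete the maximal entry `n`,
apply the map recursively, and append the label of the active site at which `n` was inserted.
The empty permutation goes to the empty sequence, hence `1` goes to `(0)`. -/
def Lam : ℕ → List ℕ → List ℕ
  | 0, _ => []
  | n + 1, π =>
    let τ := π.erase (n + 1)
    Lam n τ ++ [(activeSites τ).idxOf (π.idxOf (n + 1))]

/-- The order on pairs: increasing top entry, ties broken by decreasing bottom entry. -/
def pairLE (a b : ℕ × ℕ) : Prop := a.1 < b.1 ∨ (a.1 = b.1 ∧ b.2 ≤ a.2)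

instance instDecidableRelPairLE : DecidableRel pairLE := fun a b =>
  inferInstanceAs (Decidable (a.1 < b.1 ∨ (a.1 = b.1 ∧ b.2 ≤ a.2)))

/-- The bottom row obtained by sorting the pairs `(x̂_i, i)`, `i = 1, …, n`. -/
def sortedWord (x : List ℕ) : List ℕ :=
  (((hat x).zipIdx 1).insertionSort pairLE).map Prod.snd

/-- The entries of `π` between the active sites labelled `i` and `i + 1`
(none when these two sites do not both exist). -/
def entriesBetween (π : List ℕ) (i : ℕ) : List ℕ :=
  match (activeSites π)[i]?, (activeSites π)[i + 1]? with
  | some a, some b => (π.drop a).take (b - a)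
  | _, _ => []

end AscentPerm

namespace AscentPerm

/-! Induct on the length, strengthening the claim to the invariant `Corresponds`: the values of `hat
x` are exactly `0, …, asc x`, the active sites of `π` sit at the partial counts `numLT (hat x) i`
for `i ≤ asc x + 1`, and the maximum of `π` lies in the block numbered by the last entry of `x`.
Appending `v` inserts a new largest pair into the sorted list just before the pairs with top entry
at least `v`, so the new maximum enters at the active site labelled `v`
(`sortedWord_append_singleton`). All other active sites persist; the site just right of the new
maximum is active exactly when the old maximum lies to its left (`active_insertIdx_iff`), that is,
when `v` creates an ascent. The modified sequence then opens a gap at `v`, matching the relabelling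
of the sites. Uniqueness is the injectivity of `Lam`; the block sizes are differences of consecutive
partial counts. -/

/-! ### Ascents and the modified sequence under appending an entry. -/

/-- The last entry of `x`, or `0` for the empty sequence. -/
def lastEntry (x : List ℕ) : ℕ := x.getLast?.getD 0

@[simp] theorem lastEntry_append_singleton (x : List ℕ) (v : ℕ) : lastEntry (x ++ [v]) = v := by
  simp [lastEntry]

theorem getD_length_sub_one (x : List ℕ) : x.getD (x.length - 1) 0 = lastEntry x := by
  simp [lastEntry, List.getLast?_eq_getElem?, List.getD_eq_getElem?_getD]

theorem ascList_append_singleton (x : List ℕ) (hx : x ≠ []) (v : ℕ) :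
    ascList (x ++ [v]) = ascList x ++ if lastEntry x < v then [x.length - 1] else [] := by
  have hpos : 0 < x.length := List.length_pos_iff.mpr hx
  obtain ⟨m, hm⟩ : ∃ m, x.length = m + 1 := ⟨x.length - 1, by omega⟩
  have hlast := getD_length_sub_one x
  have h1 : (x ++ [v]).getD m 0 = lastEntry x := by
    rw [List.getD_append _ _ _ _ (by omega), ← hlast, hm]; simp
  have h2 : (x ++ [v]).getD (m + 1) 0 = v := by
    rw [List.getD_append_right _ _ _ _ (by omega)]; simp [hm]
  unfold ascList
  simp only [List.length_append, List.length_singleton, Nat.add_sub_cancel, hm, List.range_succ,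
    List.filter_append, List.filter_singleton, h1, h2]
  congr 1
  · apply List.filter_congr
    intro j hj
    have hj := List.mem_range.mp hj
    rw [List.getD_append _ _ _ _ (by omega), List.getD_append _ _ _ _ (by omega)]
  · by_cases h : lastEntry x < v <;> simp [h]

theorem asc_append_singleton (x : List ℕ) (hx : x ≠ []) (v : ℕ) :
    asc (x ++ [v]) = asc x + if lastEntry x < v then 1 else 0 := by
  unfold asc
  rw [ascList_append_singleton x hx]
  split_ifs <;> simp

theorem add_one_lt_of_mem_ascList {x : List ℕ} {i : ℕ} (hi : i ∈ ascList x) :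
    i + 1 < x.length := by
  have := List.mem_range.mp (List.mem_filter.mp hi).1
  omega

@[simp] theorem length_bump (l : List ℕ) (i : ℕ) : (bump l i).length = l.length := by
  simp [bump]

theorem bump_append_singleton (l : List ℕ) (v i : ℕ) (hi : i + 1 < l.length) :
    bump (l ++ [v]) i = bump l i ++ [v] := by
  unfold bump
  rw [List.mapIdx_append_one, List.getD_append _ _ _ _ hi, if_neg (by omega)]

theorem foldl_bump_append_singleton (is l : List ℕ) (v : ℕ) (h : ∀ i ∈ is, i + 1 < l.length) :
    is.foldl bump (l ++ [v]) = is.foldl bump l ++ [v] := by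
  induction is generalizing l with
  | nil => rfl
  | cons i is ih =>
    rw [List.foldl_cons, bump_append_singleton _ _ _ (h i (by simp)), ih, List.foldl_cons]
    intro j hj
    simpa using h j (by simp [hj])

@[simp] theorem length_foldl_bump (is l : List ℕ) : (is.foldl bump l).length = l.length := by
  induction is generalizing l with
  | nil => rfl
  | cons i is ih => rw [List.foldl_cons, ih, length_bump]

@[simp] theorem length_hat (x : List ℕ) : (hat x).length = x.length := length_foldl_bump _ _

/-- The effect on earlier entries of an ascent to `v`. -/
def shift (v u : ℕ) : ℕ := if v ≤ u then u + 1 else u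

/-- The pass skips the ascent bottom `a`, but `a < v` makes `shift v` fix it, so one uniform map
describes the pass. -/
theorem bump_append_singleton_last (l : List ℕ) (a v : ℕ) (h : a < v) :
    bump (l ++ [a] ++ [v]) l.length = (l ++ [a]).map (shift v) ++ [v] := by
  have hv : (l ++ [a] ++ [v]).getD (l.length + 1) 0 = v := by
    rw [List.getD_append_right _ _ _ _ (by simp)]; simp
  unfold bump
  rw [hv, List.mapIdx_append_one, List.mapIdx_append_one, List.map_append, List.mapIdx_eq_zipIdx_map]
  have : (l.zipIdx.map fun x => if x.2 < l.length ∧ v ≤ x.1 then x.1 + 1 else x.1)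
      = l.map (shift v) := by
    conv_rhs => rw [← List.zipIdx_map_fst 0 l, List.map_map]
    apply List.map_congr_left
    rintro ⟨u, j⟩ hj
    have : j < l.length := by
      have := List.snd_lt_of_mem_zipIdx hj; omega
    simp [shift, this]
  rw [this]
  simp [shift, h]

/-- The modified sequence one step further. -/
theorem hat_append_singleton (x : List ℕ) (hx : x ≠ []) (v : ℕ) :
    hat (x ++ [v]) = (if lastEntry x < v then (hat x).map (shift v) else hat x) ++ [v] := by
  have hstep : ∀ (y : List ℕ) (w : ℕ), (ascList y).foldl bump (y ++ [w]) = hat y ++ [w] :=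
    fun y w => foldl_bump_append_singleton _ _ _ fun i hi => add_one_lt_of_mem_ascList hi
  induction x using List.reverseRecOn generalizing v with
  | nil => exact absurd rfl hx
  | append_singleton y a ih =>
    -- No pass alters the last entry, so the new ascent still starts from the value `a`.
    obtain ⟨h', hh, hl⟩ : ∃ h', hat (y ++ [a]) = h' ++ [a] ∧ h'.length = y.length := by
      rcases eq_or_ne y [] with rfl | hy
      · exact ⟨[], by simp [hat, ascList], rfl⟩
      · rw [ih hy]
        refine ⟨_, rfl, ?_⟩
        split_ifs <;> simp
    unfold hat
    rw [ascList_append_singleton _ hx, List.foldl_append, hstep]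
    split_ifs with h
    · rw [lastEntry_append_singleton] at h
      have := bump_append_singleton_last h' a v h
      simp only [List.foldl_cons, List.foldl_nil, List.length_append, List.length_singleton,
        Nat.add_sub_cancel]
      rw [← hl, hh, this, ← hh]
      rfl
    · rfl

theorem shift_strictMono (v : ℕ) : StrictMono (shift v) := by
  intro a b hab
  unfold shift
  split_ifs <;> omega

theorem le_shift_iff (v u : ℕ) : v ≤ shift v u ↔ v ≤ u := by
  unfold shift
  split_ifs <;> omega

/-! ### Sorting pairs by insertion. -/

instance instTotalPairLE : Std.Total pairLE := ⟨fun a b => by unfold pairLE; omega⟩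

instance instTransPairLE : IsTrans (ℕ × ℕ) pairLE := ⟨fun a b c => by unfold pairLE; omega⟩

instance instAntisymmPairLE : Std.Antisymm pairLE :=
  ⟨fun a b h h' => by unfold pairLE at h h'; ext <;> omega⟩

/-- The number of entries of `h` smaller than `v`. -/
def numLT (h : List ℕ) (v : ℕ) : ℕ := h.countP (· < v)

/-- Ties are broken by decreasing second entry and `m` is maximal, so the new pair precedes all
pairs with equal first entry. -/
theorem orderedInsert_pairLE (l : List (ℕ × ℕ)) (hl : l.Pairwise pairLE) (v m : ℕ)
    (hm : ∀ b ∈ l, b.2 ≤ m) :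
    l.orderedInsert pairLE (v, m) = l.insertIdx (numLT (l.map Prod.fst) v) (v, m) := by
  induction l with
  | nil => rfl
  | cons b l ih =>
    rw [List.pairwise_cons] at hl
    have hb := hm b (by simp)
    by_cases hv : v ≤ b.1
    · rw [List.orderedInsert_cons, if_pos (by unfold pairLE; simp only; omega)]
      have : numLT ((b :: l).map Prod.fst) v = 0 := by
        simp only [numLT, List.countP_eq_zero, List.mem_map, decide_eq_true_eq, not_lt]
        rintro _ ⟨c, hc, rfl⟩
        rcases List.mem_cons.mp hc with rfl | hc
        · exact hv
        · have := hl.1 c hc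
          unfold pairLE at this; omega
      rw [this, List.insertIdx_zero]
    · rw [List.orderedInsert_cons, if_neg (by unfold pairLE; simp only; omega),
        ih hl.2 fun c hc => hm c (by simp [hc])]
      have : numLT ((b :: l).map Prod.fst) v = numLT (l.map Prod.fst) v + 1 := by
        simp only [numLT, List.map_cons]
        rw [List.countP_cons_of_pos (by simpa using hv)]
      rw [this, List.insertIdx_succ_cons]

theorem numLT_map {f : ℕ → ℕ} (h : List ℕ) (v w : ℕ) (hf : ∀ u, f u < v ↔ u < w) :
    numLT (h.map f) v = numLT h w := by
  simp [numLT, List.countP_map, Function.comp_def, hf]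

theorem map_insertIdx {α β : Type*} (f : α → β) (l : List α) (i : ℕ) (a : α) :
    (l.insertIdx i a).map f = (l.map f).insertIdx i (f a) := by
  induction l generalizing i with
  | nil => cases i <;> simp
  | cons b l ih => cases i <;> simp [ih]

/-- Sorting after a monotone relabelling of the first entries and the addition of a pair. -/
theorem insertionSort_zipIdx_append_singleton {f : ℕ → ℕ} (hf : StrictMono f) (h : List ℕ)
    (v : ℕ) (hv : ∀ u, v ≤ f u ↔ v ≤ u) :
    (((h.map f ++ [v]).zipIdx 1).insertionSort pairLE).map Prod.snd =
      (((h.zipIdx 1).insertionSort pairLE).map Prod.snd).insertIdx (numLT h v) (h.length + 1) := by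
  have hsort := List.pairwise_insertionSort pairLE (h.zipIdx 1)
  set S := (h.zipIdx 1).insertionSort pairLE with hS
  have hperm : S.Perm (h.zipIdx 1) := List.perm_insertionSort _ _
  have hsort' : (S.map (Prod.map f id)).Pairwise pairLE := by
    rw [List.pairwise_map]
    refine hsort.imp ?_
    rintro a b (hab | ⟨hab, hab'⟩)
    · exact Or.inl (hf hab)
    · exact Or.inr ⟨congrArg f hab, hab'⟩
  have key : ((h.map f ++ [v]).zipIdx 1).insertionSort pairLE =
      (S.map (Prod.map f id)).orderedInsert pairLE (v, h.length + 1) := by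
    -- Antisymmetry of `pairLE` makes the sorted arrangement unique.
    refine List.Perm.eq_of_pairwise' (List.pairwise_insertionSort _ _)
      (hsort'.orderedInsert _ _) ?_
    refine (List.perm_insertionSort _ _).trans
      (List.Perm.trans ?_ (List.perm_orderedInsert _ _ _).symm)
    rw [List.zipIdx_append, List.zipIdx_map]
    simp only [List.length_map, List.zipIdx_singleton]
    refine List.perm_append_comm.trans ?_
    rw [List.singleton_append, Nat.add_comm 1]
    exact (hperm.symm.map _).cons _
  rw [key, orderedInsert_pairLE _ hsort', map_insertIdx]
  · have h1 : (S.map (Prod.map f id)).map Prod.snd = S.map Prod.snd := by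
      simp [Function.comp_def]
    have h2 : (S.map (Prod.map f id)).map Prod.fst = (S.map Prod.fst).map f := by
      simp [Function.comp_def]
    have h3 : numLT (S.map Prod.fst) v = numLT h v := by
      have := (hperm.map Prod.fst).countP_eq (· < v)
      rwa [List.zipIdx_map_fst] at this
    rw [h1, h2, numLT_map _ _ v, h3]
    intro u
    have := hv u
    omega
  · intro b hb
    obtain ⟨c, hc, rfl⟩ := List.mem_map.mp hb
    have := List.snd_lt_of_mem_zipIdx (hperm.subset hc)
    simp only [Prod.map_snd, id]
    omega

theorem sortedWord_append_singleton (x : List ℕ) (hx : x ≠ []) (v : ℕ) :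
    sortedWord (x ++ [v]) = (sortedWord x).insertIdx (numLT (hat x) v) (x.length + 1) := by
  unfold sortedWord
  rw [hat_append_singleton x hx, ← length_hat x]
  split_ifs with h
  · exact insertionSort_zipIdx_append_singleton (shift_strictMono v) _ v (le_shift_iff v)
  · simpa using insertionSort_zipIdx_append_singleton strictMono_id (hat x) v fun _ => Iff.rfl

theorem IsAscentSeq.of_append_singleton {x : List ℕ} {v : ℕ} (h : IsAscentSeq (x ++ [v])) :
    IsAscentSeq x := by
  refine ⟨fun h0 => ?_, fun i hi h1 => ?_⟩
  · have := h.1 (by simp)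
    rwa [List.getElem_append_left h0] at this
  · have := h.2 i (by simp; omega) h1
    rwa [List.getElem_append_left hi, List.take_append_of_le_length hi.le] at this

theorem IsAscentSeq.le_one_add_asc {x : List ℕ} {v : ℕ} (h : IsAscentSeq (x ++ [v]))
    (hx : x ≠ []) : v ≤ 1 + asc x := by
  simpa using h.2 x.length (by simp) (List.length_pos_iff.mpr hx)

/-! ### Pattern avoidance and insertion of a maximum. -/

/-- In the word `A ++ B`, the last entry of `A` does not exceed any entry of `B` by exactly one. -/
def SiteOK (A B : List ℕ) : Prop := ∀ a ∈ A.getLast?, ∀ c ∈ B, a ≠ c + 1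

/-- Pattern avoidance, entry by entry. -/
def AvoidsRec : List ℕ → Prop
  | [] => True
  | a :: l => ((∃ b ∈ l.head?, a < b) → ∀ c ∈ l, a ≠ c + 1) ∧ AvoidsRec l

theorem avoids_iff_getElem (l : List ℕ) :
    Avoids l ↔ ∀ (i k : ℕ) (hi : i + 1 < l.length) (hk : k < l.length), i < k →
      l[i] < l[i + 1] → l[i] ≠ l[k] + 1 := by
  constructor
  · intro h i k hi hk hik hlt heq
    have hne : k ≠ i + 1 := by
      rintro rfl
      omega
    rcases h ⟨i, by omega⟩ ⟨i + 1, hi⟩ ⟨k, hk⟩ (by simp) (by simp; omega)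
      ⟨by simp; omega, by simpa using hlt⟩ with h | h
    · exact h rfl
    · exact h heq
  · rintro h ⟨i, hi⟩ ⟨j, hj⟩ ⟨k, hk⟩ hij hjk ⟨_, hlt⟩
    by_cases hji : j = i + 1
    · subst hji
      refine Or.inr (h i k hj hk ?_ hlt)
      simp only [Fin.mk_lt_mk] at hij hjk
      omega
    · exact Or.inl hji

theorem avoids_iff_avoidsRec (l : List ℕ) : Avoids l ↔ AvoidsRec l := by
  induction l with
  | nil => exact ⟨fun _ => trivial, fun _ i => i.elim0⟩
  | cons a l ih =>
    rw [AvoidsRec, ← ih, avoids_iff_getElem, avoids_iff_getElem]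
    constructor
    · intro h
      refine ⟨?_, fun i k hi hk hik => ?_⟩
      · rintro ⟨b, hb, hab⟩ c hc
        obtain ⟨k, hk, rfl⟩ := List.getElem_of_mem hc
        have hl : 0 < l.length := by omega
        have hb' : l[0] = b := by
          rw [List.head?_eq_getElem?, List.getElem?_eq_getElem hl] at hb
          simpa using hb
        exact h 0 (k + 1) (by simpa using hl) (by simpa using hk) (by omega)
          (by simpa [hb'] using hab)
      · exact h (i + 1) (k + 1) (by simpa using hi) (by simpa using hk) (by omega)
    · rintro ⟨h0, h⟩ i k hi hk hik hlt
      obtain ⟨k, rfl⟩ : ∃ k', k = k' + 1 := ⟨k - 1, by omega⟩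
      have hk' : k < l.length := by simpa using hk
      rcases i with _ | i
      · have hl : 0 < l.length := by omega
        refine h0 ⟨l[0], ?_, by simpa using hlt⟩ _ (List.getElem_mem hk')
        rw [List.head?_eq_getElem?, List.getElem?_eq_getElem hl]
        rfl
      · simpa using h i k (by simpa using hi) hk' (by omega) (by simpa using hlt)

/-- The letter `m` can only be the middle of a pattern, whose first letter is then the last of `A`.
The one adjacency lost, across the site, could start a pattern only if `SiteOK` fails. -/
theorem avoidsRec_append_cons (A B : List ℕ) (m : ℕ) (hA : ∀ a ∈ A, a < m) (hB : ∀ b ∈ B, b < m) :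
    AvoidsRec (A ++ m :: B) ↔ AvoidsRec (A ++ B) ∧ SiteOK A B := by
  induction A with
  | nil =>
    have : ¬ ∃ b ∈ B.head?, m < b := by
      rintro ⟨b, hb, hm⟩
      have := hB b (List.mem_of_mem_head? hb)
      omega
    rw [List.nil_append, List.nil_append, AvoidsRec]
    simp only [this, SiteOK]
    simp
  | cons a A ih =>
    have ih := ih fun a ha => hA a (by simp [ha])
    have ham : a < m := hA a (by simp)
    have hne : a ≠ m + 1 := by omega
    rw [List.cons_append, List.cons_append, AvoidsRec, AvoidsRec, ih]
    cases A with
    | nil =>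
      simp only [SiteOK, List.nil_append, List.head?_cons, List.mem_cons, Option.mem_def,
        Option.some.injEq, List.getLast?_singleton, List.getLast?_nil, forall_eq_or_imp,
        exists_eq_left', ham, hne, ne_eq, not_false_eq_true, true_and, forall_const,
        reduceCtorEq, IsEmpty.forall_iff, and_true, forall_eq']
      tauto
    | cons a' A =>
      simp only [SiteOK, List.getLast?_cons_cons, List.cons_append, List.head?_cons,
        List.mem_cons, List.mem_append, Option.mem_def, Option.some.injEq, exists_eq_left']
      grind

theorem mem_R_iff {n : ℕ} {π : List ℕ} :
    π ∈ R n ↔ π.Perm (List.range' 1 n) ∧ AvoidsRec π := by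
  rw [← avoids_iff_avoidsRec]; rfl

theorem length_of_mem_R {n : ℕ} {π : List ℕ} (h : π ∈ R n) : π.length = n := by
  simpa using h.1.length_eq

theorem mem_iff_of_mem_R {n : ℕ} {π : List ℕ} (h : π ∈ R n) (a : ℕ) : a ∈ π ↔ 1 ≤ a ∧ a ≤ n := by
  rw [h.1.mem_iff, List.mem_range'_1]
  omega

theorem append_cons_mem_R_iff {n : ℕ} {A B : List ℕ} :
    A ++ (n + 1) :: B ∈ R (n + 1) ↔ A ++ B ∈ R n ∧ SiteOK A B := by
  have hperm : (A ++ (n + 1) :: B).Perm (List.range' 1 (n + 1)) ↔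
      (A ++ B).Perm (List.range' 1 n) := by
    rw [List.range'_1_concat, Nat.add_comm 1 n]
    constructor
    · intro h
      have := List.perm_middle.symm.trans (h.trans List.perm_append_comm)
      exact this.cons_inv
    · intro h
      exact List.perm_middle.trans ((h.cons _).trans (List.perm_append_comm (l₁ := [n + 1])))
  rw [mem_R_iff, mem_R_iff, hperm, and_assoc]
  refine and_congr_right fun h => ?_
  have hlt : ∀ a ∈ A ++ B, a < n + 1 := by
    intro a ha
    have := List.mem_range'_1.mp (h.subset ha)
    omega
  exact avoidsRec_append_cons A B _ (fun a ha => hlt a (by simp [ha]))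
    fun b hb => hlt b (by simp [hb])

theorem insertIdx_eq_take_append_cons {α : Type*} (l : List α) (p : ℕ) (hp : p ≤ l.length)
    (a : α) : l.insertIdx p a = l.take p ++ a :: l.drop p := by
  induction l generalizing p with
  | nil => obtain rfl : p = 0 := by simpa using hp
           rfl
  | cons b l ih =>
    cases p with
    | zero => rfl
    | succ p => simp [ih p (by simpa using hp)]

theorem active_iff {n : ℕ} {π : List ℕ} (h : π ∈ R n) {p : ℕ} (hp : p ≤ n) :
    Active π p ↔ SiteOK (π.take p) (π.drop p) := by
  have hl := length_of_mem_R h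
  unfold Active
  rw [insertIdx_eq_take_append_cons _ _ (by omega), hl, append_cons_mem_R_iff,
    List.take_append_drop]
  simp [h]

theorem insertIdx_mem_R {n : ℕ} {π : List ℕ} (h : π ∈ R n) {p : ℕ} (hp : Active π p) :
    π.insertIdx p (n + 1) ∈ R (n + 1) := by
  rw [← length_of_mem_R h]; exact hp

/-! ### Injectivity of `Lam` and propagation of active sites. -/

/-- A permutation in `R (n + 1)` arises by inserting `n + 1` in an active site. -/
theorem exists_eq_insertIdx {n : ℕ} {π : List ℕ} (h : π ∈ R (n + 1)) :
    π.erase (n + 1) ∈ R n ∧ π.idxOf (n + 1) ∈ activeSites (π.erase (n + 1)) ∧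
      π = (π.erase (n + 1)).insertIdx (π.idxOf (n + 1)) (n + 1) := by
  obtain ⟨A, B, hA, rfl, hE⟩ := List.exists_erase_eq ((mem_iff_of_mem_R h (n + 1)).mpr (by omega))
  have hR := (append_cons_mem_R_iff.mp h).1
  have hidx : (A ++ (n + 1) :: B).idxOf (n + 1) = A.length := by
    rw [List.idxOf_append_of_notMem hA]; simp
  have hins : (A ++ B).insertIdx A.length (n + 1) = A ++ (n + 1) :: B := by
    rw [insertIdx_eq_take_append_cons _ _ (by simp)]; simp
  rw [hE, hidx, hins]
  refine ⟨hR, ?_, rfl⟩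
  rw [activeSites, List.mem_filter, List.mem_range]
  refine ⟨by simp, ?_⟩
  rw [decide_eq_true_eq, Active, length_of_mem_R hR, hins]
  exact h

theorem erase_insertIdx_self {n : ℕ} {π : List ℕ} (h : π ∈ R n) {p : ℕ} (hp : p ≤ n) :
    (π.insertIdx p (n + 1)).erase (n + 1) = π ∧ (π.insertIdx p (n + 1)).idxOf (n + 1) = p := by
  have hl := length_of_mem_R h
  have hn : n + 1 ∉ π.take p := fun hm => by
    have := (mem_iff_of_mem_R h _).mp (List.mem_of_mem_take hm)
    omega
  rw [insertIdx_eq_take_append_cons _ _ (by omega), List.erase_append_right _ hn,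
    List.idxOf_append_of_notMem hn]
  simp only [List.erase_cons_head, List.take_append_drop, List.idxOf_cons_self, add_zero,
    List.length_take, true_and]
  omega

theorem Lam_injOn (n : ℕ) {π σ : List ℕ} (hπ : π ∈ R n) (hσ : σ ∈ R n)
    (h : Lam n π = Lam n σ) : π = σ := by
  induction n generalizing π σ with
  | zero =>
    rw [List.eq_nil_of_length_eq_zero (length_of_mem_R hπ),
      List.eq_nil_of_length_eq_zero (length_of_mem_R hσ)]
  | succ n ih =>
    obtain ⟨hπR, hπa, hπe⟩ := exists_eq_insertIdx hπ
    obtain ⟨hσR, _, hσe⟩ := exists_eq_insertIdx hσ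
    simp only [Lam] at h
    obtain ⟨h1, h2⟩ := List.append_inj' h rfl
    have he := ih hπR hσR h1
    rw [← he] at h2 hσe
    rw [List.cons.injEq, List.idxOf_inj hπa] at h2
    rw [hπe, hσe, h2.1]

theorem Lam_insertIdx {n : ℕ} {π : List ℕ} (h : π ∈ R n) {p : ℕ} (hp : p ≤ n) :
    Lam (n + 1) (π.insertIdx p (n + 1)) = Lam n π ++ [(activeSites π).idxOf p] := by
  obtain ⟨h1, h2⟩ := erase_insertIdx_self h hp
  simp only [Lam, h1, h2]

/-- The active sites after the insertion of a new maximum at the active site `p`. -/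
theorem active_insertIdx_iff {n : ℕ} {π : List ℕ} (h : π ∈ R n) {p q : ℕ} (hp : p ≤ n)
    (hpa : Active π p) (hq : q ≤ n + 1) :
    Active (π.insertIdx p (n + 1)) q ↔
      (q ≤ p ∧ Active π q) ∨ (q = p + 1 ∧ n ∉ π.drop p) ∨ (p + 2 ≤ q ∧ Active π (q - 1)) := by
  have hl := length_of_mem_R h
  have hlt : ∀ a ∈ π, a ≤ n := fun a ha => ((mem_iff_of_mem_R h a).mp ha).2
  rw [active_iff (insertIdx_mem_R h hpa) hq, insertIdx_eq_take_append_cons _ _ (by omega)]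
  have hlen : (π.take p).length = p := by simp; omega
  rcases lt_trichotomy q (p + 1) with hqp | rfl | hqp
  · have hqp : q ≤ p := by omega
    have h1 : (π.take p ++ (n + 1) :: π.drop p).take q = π.take q := by
      rw [List.take_append_of_le_length (by omega), List.take_take, min_eq_left hqp]
    have h2 : (π.take p ++ (n + 1) :: π.drop p).drop q =
        (π.take p).drop q ++ (n + 1) :: π.drop p := List.drop_append_of_le_length (by omega)
    have h3 : π.drop q = (π.take p).drop q ++ π.drop p := by
      rw [← List.drop_append_of_le_length (by omega), List.take_append_drop]
    rw [active_iff h (by omega), h1, h2]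
    have : SiteOK (π.take q) ((π.take p).drop q ++ (n + 1) :: π.drop p) ↔
        SiteOK (π.take q) (π.drop q) := by
      rw [h3]
      refine forall₂_congr fun a ha => ?_
      have := hlt a (List.mem_of_mem_take (List.mem_of_mem_getLast? ha))
      simp only [List.mem_append, List.mem_cons]
      constructor
      · rintro H c (hc | hc)
        · exact H c (Or.inl hc)
        · exact H c (Or.inr (Or.inr hc))
      · rintro H c (hc | rfl | hc)
        · exact H c (Or.inl hc)
        · omega
        · exact H c (Or.inr hc)
    rw [this]
    have e1 : q ≠ p + 1 := by omega
    have e2 : ¬ p + 2 ≤ q := by omega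
    simp [hqp, e1, e2]
  -- The prefix now ends in `n + 1`, so only `n` to its right can obstruct.
  · have h1 : (π.take p ++ (n + 1) :: π.drop p).take (p + 1) = π.take p ++ [n + 1] := by
      rw [List.take_append, hlen, List.take_of_length_le (by omega)]; simp
    have h2 : (π.take p ++ (n + 1) :: π.drop p).drop (p + 1) = π.drop p := by
      rw [List.drop_append, hlen, List.drop_of_length_le (by omega)]; simp
    rw [h1, h2]
    simp [SiteOK]
    exact ⟨fun H hn => H n hn rfl, fun H c hc hcn => H (hcn ▸ hc)⟩
  · obtain ⟨r, rfl⟩ : ∃ r, q = p + 1 + (r + 1) := ⟨q - p - 2, by omega⟩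
    have h1 : (π.take p ++ (n + 1) :: π.drop p).take (p + 1 + (r + 1)) =
        π.take p ++ (n + 1) :: (π.drop p).take (r + 1) := by
      rw [List.take_append, hlen, List.take_of_length_le (by omega),
        show p + 1 + (r + 1) - p = r + 1 + 1 by omega, List.take_succ_cons]
    have h2 : (π.take p ++ (n + 1) :: π.drop p).drop (p + 1 + (r + 1)) =
        π.drop (p + (r + 1)) := by
      rw [List.drop_append, hlen, List.drop_of_length_le (by omega),
        show p + 1 + (r + 1) - p = r + 1 + 1 by omega, List.drop_succ_cons, List.drop_drop,
        List.nil_append]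
    have h3 : π.take (p + (r + 1)) = π.take p ++ (π.drop p).take (r + 1) := by
      rw [List.take_add]
    -- Some letter follows `n + 1` in the prefix, so its last letter is unchanged.
    have hne : (π.drop p).take (r + 1) ≠ [] := by
      intro H
      have := congrArg List.length H
      simp at this
      omega
    rw [h1, h2, show p + 1 + (r + 1) - 1 = p + (r + 1) by omega, active_iff h (p := p + (r + 1)) (by omega),
      h3]
    have : SiteOK (π.take p ++ (n + 1) :: (π.drop p).take (r + 1)) (π.drop (p + (r + 1))) ↔
        SiteOK (π.take p ++ (π.drop p).take (r + 1)) (π.drop (p + (r + 1))) := by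
      unfold SiteOK
      obtain ⟨b, l, hbl⟩ := List.exists_cons_of_ne_nil hne
      rw [hbl, List.getLast?_append_cons, List.getLast?_append_cons, List.getLast?_cons_cons]
    rw [this]
    have e1 : ¬ p + 1 + (r + 1) ≤ p := by omega
    have e3 : p + 2 ≤ p + 1 + (r + 1) := by omega
    simp [e1, e3]

/-! ### Partial counts of the modified sequence. -/

theorem numLT_mono (h : List ℕ) : Monotone (numLT h) := by
  intro a b hab
  refine List.countP_mono_left fun u _ hu => ?_
  simp only [decide_eq_true_eq] at hu ⊢
  omega

theorem numLT_succ (h : List ℕ) (i : ℕ) : numLT h (i + 1) = numLT h i + h.count i := by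
  induction h with
  | nil => rfl
  | cons a h ih =>
    simp only [numLT, List.countP_cons, List.count_cons, decide_eq_true_eq, beq_iff_eq] at ih ⊢
    split_ifs <;> omega

theorem numLT_lt_of_mem {h : List ℕ} {i j : ℕ} (hi : i ∈ h) (hij : i < j) :
    numLT h i < numLT h j := by
  have h1 := numLT_succ h i
  have h2 := List.count_pos_iff.mpr hi
  have h3 := numLT_mono h (show i + 1 ≤ j from hij)
  omega

theorem numLT_le_length (h : List ℕ) (i : ℕ) : numLT h i ≤ h.length := List.countP_le_length

theorem numLT_append_singleton (h : List ℕ) (v i : ℕ) :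
    numLT (h ++ [v]) i = numLT h i + if v < i then 1 else 0 := by
  simp [numLT, List.countP_append, List.countP_singleton]

theorem numLT_map_shift_of_le (h : List ℕ) {v i : ℕ} (hi : i ≤ v) :
    numLT (h.map (shift v)) i = numLT h i :=
  numLT_map _ _ _ fun u => by unfold shift; split_ifs <;> omega

theorem numLT_map_shift_succ (h : List ℕ) {v i : ℕ} (hi : v ≤ i) :
    numLT (h.map (shift v)) (i + 1) = numLT h i :=
  numLT_map _ _ _ fun u => by unfold shift; split_ifs <;> omega

/-! ### The inductive invariant. -/

/-- The relation between an ascent sequence and the permutation that corresponds to it. -/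
structure Corresponds (x π : List ℕ) : Prop where
  mem_R : π ∈ R x.length
  Lam_eq : Lam x.length π = x
  mem_hat_iff : ∀ u, u ∈ hat x ↔ u ≤ asc x
  lastEntry_le : lastEntry x ≤ asc x
  active_iff : ∀ p ≤ x.length, Active π p ↔ ∃ i ≤ asc x + 1, numLT (hat x) i = p
  length_mem_drop_iff : ∀ i, x.length ∈ π.drop (numLT (hat x) i) ↔ i ≤ lastEntry x

/-- Each of `0, …, asc x` occurs in `hat x`, so no two of these partial counts coincide. -/
theorem Corresponds.numLT_lt_iff {x π : List ℕ} (h : Corresponds x π) {i j : ℕ}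
    (hi : i ≤ asc x + 1) (hj : j ≤ asc x + 1) :
    numLT (hat x) i < numLT (hat x) j ↔ i < j := by
  constructor
  · intro hlt
    by_contra hge
    have := numLT_mono (hat x) (not_lt.mp hge)
    omega
  · exact fun hij => numLT_lt_of_mem ((h.mem_hat_iff i).mpr (by omega)) hij

theorem Corresponds.activeSites_eq {x π : List ℕ} (h : Corresponds x π) :
    activeSites π = (List.range (asc x + 2)).map (numLT (hat x)) := by
  have hl := length_of_mem_R h.mem_R
  refine List.SortedLT.eq_of_mem_iff ?_ ?_ ?_
  · exact (List.pairwise_lt_range.filter _).sortedLT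
  · refine List.Pairwise.sortedLT ?_
    rw [List.pairwise_map]
    refine List.pairwise_lt_range.imp_of_mem fun hi hj hij => ?_
    rw [List.mem_range] at hi hj
    exact (h.numLT_lt_iff (by omega) (by omega)).mpr hij
  · intro p
    simp only [activeSites, List.mem_filter, List.mem_range, List.mem_map, decide_eq_true_eq, hl]
    constructor
    · rintro ⟨hp, hpa⟩
      obtain ⟨i, hi, rfl⟩ := (h.active_iff p (by omega)).mp hpa
      exact ⟨i, by omega, rfl⟩
    · rintro ⟨i, hi, rfl⟩
      have hle : numLT (hat x) i ≤ x.length := by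
        simpa using numLT_le_length (hat x) i
      exact ⟨by omega, (h.active_iff _ hle).mpr ⟨i, by omega, rfl⟩⟩

theorem Corresponds.idxOf_activeSites {x π : List ℕ} (h : Corresponds x π) {v : ℕ}
    (hv : v ≤ asc x + 1) : (activeSites π).idxOf (numLT (hat x) v) = v := by
  have hnodup : (activeSites π).Nodup := List.nodup_range.filter _
  have hlen : v < (activeSites π).length := by
    rw [h.activeSites_eq]; simp; omega
  have := hnodup.idxOf_getElem v hlen
  rwa [show (activeSites π)[v] = numLT (hat x) v by simp [h.activeSites_eq]] at this

theorem corresponds_singleton_zero : Corresponds [0] [1] where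
  mem_R := by decide
  Lam_eq := by decide
  mem_hat_iff u := by
    have h1 : hat [0] = [0] := by decide
    have h2 : asc [0] = 0 := by decide
    simp [h1, h2]
  lastEntry_le := by decide
  active_iff p hp := by
    have h1 : ∀ p ≤ 1, Active [1] p := by decide
    have h2 : ∀ p ≤ 1, numLT (hat [0]) p = p := by decide
    exact ⟨fun _ => ⟨p, by simpa [asc, ascList] using hp, h2 p hp⟩, fun _ => h1 p hp⟩
  length_mem_drop_iff i := by
    have h1 : hat [0] = [0] := by decide
    rw [h1]
    rcases i with _ | i <;> simp [numLT, lastEntry]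

/-- Appending an entry to the sequence corresponds to inserting a new maximum. -/
theorem Corresponds.append_singleton {x π : List ℕ} (h : Corresponds x π) (hx : x ≠ []) {v : ℕ}
    (hv : v ≤ 1 + asc x) :
    Corresponds (x ++ [v]) (π.insertIdx (numLT (hat x) v) (x.length + 1)) := by
  have hl := length_of_mem_R h.mem_R
  have hle : ∀ i, numLT (hat x) i ≤ x.length := fun i => by
    simpa using numLT_le_length (hat x) i
  have hact : Active π (numLT (hat x) v) :=
    (h.active_iff _ (hle v)).mpr ⟨v, by omega, rfl⟩
  have hlast := h.lastEntry_le
  have hasc := asc_append_singleton x hx v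
  have hhat := hat_append_singleton x hx v
  -- Thresholds above `v` also count the new entry; at an ascent they count the old entries as the
  -- previous threshold did.
  have hnum : ∀ i, numLT (hat (x ++ [v])) i = if i ≤ v then numLT (hat x) i else
      numLT (hat x) (if lastEntry x < v then i - 1 else i) + 1 := by
    intro i
    rw [hhat, numLT_append_singleton]
    by_cases hiv : i ≤ v
    · rw [if_pos hiv, if_neg (show ¬ v < i by omega), add_zero]
      by_cases hlv : lastEntry x < v
      · rw [if_pos hlv, numLT_map_shift_of_le _ hiv]
      · rw [if_neg hlv]
    · rw [if_neg hiv, if_pos (show v < i by omega)]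
      by_cases hlv : lastEntry x < v
      · obtain ⟨i, rfl⟩ : ∃ i', i = i' + 1 := ⟨i - 1, by omega⟩
        rw [if_pos hlv, if_pos hlv, numLT_map_shift_succ _ (by omega), Nat.add_sub_cancel]
      · rw [if_neg hlv, if_neg hlv]
  refine ⟨?_, ?_, ?_, ?_, ?_, ?_⟩
  · rw [List.length_append, List.length_singleton]
    exact insertIdx_mem_R h.mem_R hact
  · rw [List.length_append, List.length_singleton, Lam_insertIdx h.mem_R (hle v), h.Lam_eq,
      h.idxOf_activeSites (by omega)]
  · intro u
    rw [hhat, hasc, List.mem_append, List.mem_singleton]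
    split_ifs with hlv
    · rw [List.mem_map]
      constructor
      · rintro (⟨w, hw, rfl⟩ | rfl)
        · have := (h.mem_hat_iff w).mp hw
          unfold shift
          split_ifs <;> omega
        · omega
      · intro hu
        rcases lt_trichotomy u v with huv | rfl | huv
        · exact Or.inl ⟨u, (h.mem_hat_iff u).mpr (by omega), by simp [shift]; omega⟩
        · exact Or.inr rfl
        · exact Or.inl ⟨u - 1, (h.mem_hat_iff _).mpr (by omega),
            by unfold shift; split_ifs <;> omega⟩
    · rw [h.mem_hat_iff]
      omega
  · rw [lastEntry_append_singleton, hasc]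
    split_ifs <;> omega
  · intro q hq
    rw [List.length_append, List.length_singleton] at hq
    rw [active_insertIdx_iff h.mem_R (hle v) hact hq, h.length_mem_drop_iff, hasc]
    simp only [hnum]
    constructor
    · rintro (⟨hqp, ha⟩ | ⟨rfl, hlv⟩ | ⟨hqp, ha⟩)
      · obtain ⟨i, hi, rfl⟩ := (h.active_iff q (hqp.trans (hle v))).mp ha
        have hiv : i ≤ v := by
          by_contra hc
          have := (h.numLT_lt_iff (i := v) (j := i) (by omega) hi).mpr (by omega)
          omega
        exact ⟨i, by omega, by rw [if_pos hiv]⟩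
      -- This is the extra active site, with label `v + 1`; it exists exactly at an ascent.
      · have hlv : lastEntry x < v := by omega
        refine ⟨v + 1, by rw [if_pos hlv]; omega, ?_⟩
        rw [if_neg (by omega), if_pos hlv, Nat.add_sub_cancel]
      · obtain ⟨i, hi, hiq⟩ := (h.active_iff (q - 1) (by omega)).mp ha
        have hiv : v < i := (h.numLT_lt_iff (by omega) hi).mp (by omega)
        by_cases hlv : lastEntry x < v
        · refine ⟨i + 1, by rw [if_pos hlv]; omega, ?_⟩
          rw [if_neg (by omega), if_pos hlv, Nat.add_sub_cancel]
          omega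
        · refine ⟨i, by omega, ?_⟩
          rw [if_neg (by omega), if_neg hlv]
          omega
    · rintro ⟨i, hi, rfl⟩
      by_cases hiv : i ≤ v
      · rw [if_pos hiv]
        exact Or.inl ⟨numLT_mono _ hiv, (h.active_iff _ (hle i)).mpr ⟨i, by omega, rfl⟩⟩
      · rw [if_neg hiv]
        by_cases hlv : lastEntry x < v
        · rw [if_pos hlv] at hi ⊢
          by_cases hi1 : i - 1 = v
          · rw [hi1]
            exact Or.inr (Or.inl ⟨rfl, by omega⟩)
          · have := (h.numLT_lt_iff (i := v) (j := i - 1) (by omega) (by omega)).mpr (by omega)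
            exact Or.inr (Or.inr ⟨by omega,
              (h.active_iff _ (by simpa using hle _)).mpr ⟨i - 1, by omega, by simp⟩⟩)
        · rw [if_neg hlv] at hi ⊢
          have := (h.numLT_lt_iff (i := v) (j := i) (by omega) (by omega)).mpr (by omega)
          exact Or.inr (Or.inr ⟨by omega,
            (h.active_iff _ (by simpa using hle _)).mpr ⟨i, by omega, by simp⟩⟩)
  · intro i
    have hlen : (π.take (numLT (hat x) v)).length = numLT (hat x) v := by
      have := hle v
      simp; omega
    rw [lastEntry_append_singleton, List.length_append, List.length_singleton,
      insertIdx_eq_take_append_cons _ _ (by rw [hl]; exact hle v), hnum]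
    split_ifs with hiv
    · rw [List.drop_append_of_le_length (by rw [hlen]; exact numLT_mono _ hiv)]
      simp [hiv]
    -- For `i > v` the dropped prefix contains the new maximum.
    all_goals
      refine iff_of_false (fun hm => ?_) hiv
      rw [List.drop_append, List.drop_of_length_le (by
        rw [hlen]; exact (numLT_mono _ (by omega)).trans (Nat.le_succ _)), List.nil_append, hlen] at hm
      rw [Nat.sub_add_comm (numLT_mono _ (by omega)), List.drop_succ_cons] at hm
      have := (mem_iff_of_mem_R h.mem_R _).mp (List.mem_of_mem_drop (List.mem_of_mem_drop hm))
      omega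

/-- The induction starts at `[0]`: the invariant fails for `[]`, where `asc` is `0` but `hat` has no
entry `0`. -/
theorem IsAscentSeq.corresponds {x : List ℕ} (hx : IsAscentSeq x) (hne : x ≠ []) :
    Corresponds x (sortedWord x) := by
  induction x using List.reverseRecOn with
  | nil => exact absurd rfl hne
  | append_singleton y v ih =>
    rcases eq_or_ne y [] with rfl | hy
    · obtain rfl : v = 0 := hx.1 (by simp)
      exact corresponds_singleton_zero
    · rw [sortedWord_append_singleton y hy]
      exact (ih hx.of_append_singleton hy).append_singleton hy (hx.le_one_add_asc hy)

theorem Corresponds.length_entriesBetween {x π : List ℕ} (h : Corresponds x π) (i : ℕ) :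
    (entriesBetween π i).length = (hat x).count i := by
  have hl := length_of_mem_R h.mem_R
  unfold entriesBetween
  rw [h.activeSites_eq]
  -- Label `i + 1` exists exactly when the value `i` occurs in `hat x`.
  by_cases hi : i ≤ asc x
  · have h1 : ((List.range (asc x + 2)).map (numLT (hat x)))[i]? = some (numLT (hat x) i) := by
      rw [List.getElem?_map, List.getElem?_range (by omega)]; rfl
    have h2 : ((List.range (asc x + 2)).map (numLT (hat x)))[i + 1]? =
        some (numLT (hat x) (i + 1)) := by
      rw [List.getElem?_map, List.getElem?_range (by omega)]; rfl
    rw [h1, h2]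
    have h3 := numLT_succ (hat x) i
    have h4 := numLT_le_length (hat x) (i + 1)
    rw [length_hat] at h4
    simp only [List.length_take, List.length_drop]
    omega
  · have h2 : ((List.range (asc x + 2)).map (numLT (hat x)))[i + 1]? = none := by
      rw [List.getElem?_eq_none_iff]; simp; omega
    rw [h2, List.count_eq_zero_of_not_mem (fun hm => hi ((h.mem_hat_iff i).mp hm))]
    simp

end AscentPerm

/-- `sortedWord x` is the one and only element of `R n` that `Lam` sends to `x`, and the numbers of
its entries between consecutive active sites are the multiplicities of the entries of `x̂`. -/
theorem corollary4p2 (x : List ℕ) (hx : AscentPerm.IsAscentSeq x) :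
    (∀ π : List ℕ,
      (π ∈ AscentPerm.R x.length ∧ AscentPerm.Lam x.length π = x) ↔
        π = AscentPerm.sortedWord x) ∧
    (∀ i : ℕ,
      (AscentPerm.entriesBetween (AscentPerm.sortedWord x) i).length =
        (AscentPerm.hat x).count i) := by
  have key : AscentPerm.sortedWord x ∈ AscentPerm.R x.length ∧
      AscentPerm.Lam x.length (AscentPerm.sortedWord x) = x := by
    rcases eq_or_ne x [] with rfl | hne
    · decide
    · exact ⟨(hx.corresponds hne).mem_R, (hx.corresponds hne).Lam_eq⟩
  refine ⟨fun π => ⟨fun h => ?_, fun h => h ▸ key⟩, fun i => ?_⟩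
  · exact AscentPerm.Lam_injOn _ h.1 key.1 (h.2.trans key.2.symm)
  · rcases eq_or_ne x [] with rfl | hne
    · have h1 : AscentPerm.activeSites (AscentPerm.sortedWord []) = [0] := by decide
      have h2 : AscentPerm.hat [] = [] := by decide
      rw [AscentPerm.entriesBetween, h1, h2]
      simp
    · exact (hx.corresponds hne).length_entriesBetween i
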